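/- Let $\mathcal A$ be an abelian category with enough projective and enough injective objects. A pair $(\mathcal X,\mathcal Y)$ of full subcategories is a cotorsion pair if $\mathcal X=\{X\mid \mathrm{Ext}^1_{\mathcal A}(X,Y)=0\ \forall\, Y\in\mathcal Y\}$ and $\mathcal Y=\{Y\mid \mathrm{Ext}^1_{\mathcal A}(X,Y)=0\ \forall\, X\in\mathcal X\}$. It is complete if every object $M$ admits short exact sequences $0\to Y\to X\to M\to 0$ and $0\to M\to Y'\to X'\to 0$ with $X,X'\in\mathcal X$ and $Y,Y'\in\mathcal Y$, and hereditary if $\mathcal X$ is resolving, i.e. contains all projective objects and, for every short exact sequence $0\to X'\to X\to X''\to 0$ with $X''\in\mathcal X$, one has $X\in\mathcal X$ if and only if $X'\in\mathcal X$. Let $(\mathcal X,\mathcal Z,\mathcal Y)$ be a complete and hereditary cotorsion triple, i.e. both $(\mathcal X,\mathcal Z)$ and $(\mathcal Z,\mathcal Y)$ are complete and hereditary cotorsion pairs. For an object $M$, let $\mathcal Z\text{-}\mathrm{pd}(M)$ be the smallest integer $m\ge 0$ such that $\mathrm{Ext}^{m+i}_{\mathcal A}(M,Z)=0$ for all $Z\in\mathcal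 Z$ and all $i\ge 1$, and $\infty$ if there is no such $m$. An $\mathcal X$-resolution of $M$ is a complex $\cdots\to X_1\to X_0\to M\to 0$ with all $X_i\in\mathcal X$ that becomes exact after applying $\mathrm{Hom}_{\mathcal A}(X,-)$ for every $X\in\mathcal X$. Every object has one, and it is unique up to homotopy; with $\mathbf X^\bullet=(\cdots\to X_1\to X_0\to 0)$ put $\mathrm{Ext}^i_{\mathcal{XY}}(M,N)=H^i\,\mathrm{Hom}_{\mathcal A}(\mathbf X^\bullet,N)$. For a complex $\cdots\to X_1\to X_0\to M\to 0$ put $X_{-1}=M$, $X_{-2}=0$ and $K_n=\mathrm{Ker}(X_{n-1}\to X_{n-2})$, so that $K_0=M$. Theorem 4.6. For every object $M$ of $\mathcal A$ and every integer $n\ge 0$, the following are equivalent: 1. $\mathcal Z\text{-}\mathrm{pd}(M)\le n$. 2. $\mathrm{Ext}^{n+i}_{\mathcal A}(M,Z)=0$ for all $Z\in\mathcal Z$ and $i\ge 1$. 3. $\mathrm{Ext}^{n+i}_{\mathcal{XY}}(M,N)=0$ for all $N\in\mathcal A$ and $i\ge 1$. 4. For every $\mathcal X$-resolution $\cdots\to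 X_1\to X_0\to M\to 0$ of $M$, $K_n\in\mathcal X$. 5. For some $\mathcal X$-resolution $\cdots\to X_1\to X_0\to M\to 0$ of $M$, $K_n\in\mathcal X$. 6. For every exact sequence $\cdots\to X'_1\to X'_0\to M\to 0$ with all $X'_i\in\mathcal X$, $K'_n=\mathrm{Ker}(X'_{n-1}\to X'_{n-2})\in\mathcal X$, where $X'_{-1}=M$ and $X'_{-2}=0$. -/

import Mathlib

open CategoryTheory CategoryTheory.Limits

universe v u

namespace CotorsionTriple

section Classes

variable {A : Type u} [Category.{v} A] [Abelian A]

/-- The completeness condition for a pair `(X, Y)` of classes of objects: every object `M` has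
short exact sequences `0 → Y₀ → X₀ → M → 0` and `0 → M → Y₁ → X₁ → 0` with `Xᵢ` in `X` and `Yᵢ`
in `Y`. -/
structure IsCompletePair (X Y : ObjectProperty A) : Prop where
  exists_left (M : A) : ∃ (Y₀ X₀ : A) (f : Y₀ ⟶ X₀) (g : X₀ ⟶ M) (w : f ≫ g = 0),
    (ShortComplex.mk f g w).ShortExact ∧ X X₀ ∧ Y Y₀
  exists_right (M : A) : ∃ (Y₁ X₁ : A) (f : M ⟶ Y₁) (g : Y₁ ⟶ X₁) (w : f ≫ g = 0),
    (ShortComplex.mk f g w).ShortExact ∧ X X₁ ∧ Y Y₁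

/-- A class of objects is resolving if it contains all projective objects and, for every short
exact sequence `0 → X₁ → X₂ → X₃ → 0` with `X₃` in the class, `X₂` is in the class if and only if
`X₁` is. -/
structure IsResolving (X : ObjectProperty A) : Prop where
  of_projective (P : A) : Projective P → X P
  iff_of_shortExact (S : ShortComplex A) : S.ShortExact → X S.X₃ → (X S.X₂ ↔ X S.X₁)

/-- A complex `⋯ → C₁ → C₀ → M → 0` ending in a given object `M`. -/
structure AugmentedComplex (M : A) where
  /-- the deleted complex `⋯ → C₁ → C₀ → 0` -/
  complex : ChainComplex A ℕ
  /-- the augmentation `C₀ → M` -/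
  π : complex.X 0 ⟶ M
  d_comp_π : complex.d 1 0 ≫ π = 0

namespace AugmentedComplex

variable {M : A} (R : AugmentedComplex M)

/-- The complex `⋯ → C₁ → C₀ → M → 0` is exact. -/
structure IsExact : Prop where
  epi : Epi R.π
  exact_zero : (ShortComplex.mk (R.complex.d 1 0) R.π R.d_comp_π).Exact
  exact_succ (i : ℕ) : R.complex.ExactAt (i + 1)

/-- For a fixed object `W`, the complex of abelian groups
`⋯ → Hom(W, C₁) → Hom(W, C₀) → Hom(W, M) → 0` is exact. -/
structure IsHomExact (W : A) : Prop where
  surjective : Function.Surjective (fun f : W ⟶ R.complex.X 0 => f ≫ R.π)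
  exact_zero : Function.Exact (fun f : W ⟶ R.complex.X 1 => f ≫ R.complex.d 1 0)
    (fun f : W ⟶ R.complex.X 0 => f ≫ R.π)
  exact_succ (i : ℕ) : Function.Exact
    (fun f : W ⟶ R.complex.X (i + 2) => f ≫ R.complex.d (i + 2) (i + 1))
    (fun f : W ⟶ R.complex.X (i + 1) => f ≫ R.complex.d (i + 1) i)

/-- `⋯ → C₁ → C₀ → M → 0` is an `X`-resolution of `M`: all `Cᵢ` lie in `X`, and the complex
becomes exact after applying `Hom(W, -)` for every `W` in `X`. -/
structure IsResolution (X : ObjectProperty A) : Prop where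
  mem (i : ℕ) : X (R.complex.X i)
  homExact (W : A) : X W → R.IsHomExact W

/-- The `n`-th kernel `Kₙ = Ker(Cₙ₋₁ → Cₙ₋₂)`, where `C₋₁ = M` and `C₋₂ = 0`; thus `K₀ = M`
and `K₁ = Ker(C₀ → M)`. -/
noncomputable def ker : ℕ → A
  | 0 => M
  | 1 => kernel R.π
  | n + 2 => kernel (R.complex.d (n + 1) n)

/-- The cochain complex of abelian groups `0 → Hom(C₀, N) → Hom(C₁, N) → ⋯`. -/
noncomputable def homComplex (N : A) : CochainComplex AddCommGrpCat.{v} ℕ :=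
  (((preadditiveYoneda.obj N).rightOp.mapHomologicalComplex _).obj R.complex).unop

end AugmentedComplex

/-- If every object `M` has a right `X`-approximation, i.e. a map `X₀ → M` with `X₀` in `X` through
which all maps from objects of `X` to `M` factor, then every object has an `X`-resolution. -/
theorem exists_isResolution (X : ObjectProperty A)
    (h : ∀ M : A, ∃ (X₀ : A) (g : X₀ ⟶ M), X X₀ ∧
      ∀ W, X W → Function.Surjective (fun f : W ⟶ X₀ => f ≫ g)) (M : A) :
    ∃ R : AugmentedComplex M, R.IsResolution X := by
  choose P p hp using h
  let dd : ∀ {B C : A} (f : B ⟶ C), P (kernel f) ⟶ B := fun f => p (kernel f) ≫ kernel.ι f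
  have dd_comp : ∀ {B C : A} (f : B ⟶ C), dd f ≫ f = 0 := fun f => by simp [dd]
  have key : ∀ {W B C : A} (f : B ⟶ C), X W → Function.Exact (fun a : W ⟶ _ => a ≫ dd f)
      (fun a : W ⟶ B => a ≫ f) := by
    intro W B C f hW a
    constructor
    · intro ha
      obtain ⟨b, hb⟩ := (hp (kernel f)).2 W hW (kernel.lift f a ha)
      refine ⟨b, ?_⟩
      have hb' : b ≫ p (kernel f) = kernel.lift f a ha := hb
      simp [dd, reassoc_of% hb']
    · rintro ⟨b, rfl⟩
      simp [dd_comp]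
  let K : ChainComplex A ℕ := ChainComplex.mk' (P M) (P (kernel (p M))) (dd (p M))
    (fun f => ⟨_, dd f, dd_comp f⟩)
  have hK10 : K.d 1 0 = dd (p M) := by simp [K]
  have hmem : ∀ i, X (K.X i) := by
    intro i
    obtain (_ | _ | _ | i) := i <;> exact (hp _).1
  refine ⟨⟨K, p M, by rw [hK10]; exact dd_comp _⟩, hmem, fun W hW => ⟨(hp M).2 W hW, ?_, ?_⟩⟩
  · change Function.Exact (fun f : W ⟶ K.X 1 => f ≫ K.d 1 0) (fun f : W ⟶ K.X 0 => f ≫ p M)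
    rw [hK10]
    exact key _ hW
  · intro i
    obtain ⟨e, he⟩ : ∃ e : K.X (i + 2) ≅ P (kernel (K.d (i + 1) i)),
        K.d (i + 2) (i + 1) = e.hom ≫ dd (K.d (i + 1) i) :=
      ⟨ChainComplex.mk'XIso _ _ _ _ i, ChainComplex.mk'_d _ _ _ _ i⟩
    change Function.Exact (fun f : W ⟶ K.X (i + 2) => f ≫ K.d (i + 2) (i + 1))
      (fun f : W ⟶ K.X (i + 1) => f ≫ K.d (i + 1) i)
    intro a
    rw [key (K.d (i + 1) i) hW a]
    constructor
    · rintro ⟨b, rfl⟩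
      exact ⟨b ≫ e.inv, by simp [he]⟩
    · rintro ⟨b, rfl⟩
      exact ⟨b ≫ e.hom, by simp [he]⟩

end Classes

section Triples

variable {A : Type u} [Category.{v} A] [Abelian A] [EnoughProjectives A]

/-- With enough projectives the `Ext`-groups are small, so that they can be taken in the universe
of the morphisms of the category. -/
instance hasExt : HasExt.{v} A :=
  hasExt_of_enoughProjectives.{v} A

/-- The class `⊥C` of all objects `M` with `Ext¹(M, N) = 0` for every `N` in `C`. -/
def leftPerp (C : ObjectProperty A) : ObjectProperty A :=
  fun M => ∀ N, C N → Subsingleton (Abelian.Ext.{v} M N 1)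

/-- The class `C⊥` of all objects `N` with `Ext¹(M, N) = 0` for every `M` in `C`. -/
def rightPerp (C : ObjectProperty A) : ObjectProperty A :=
  fun N => ∀ M, C M → Subsingleton (Abelian.Ext.{v} M N 1)

/-- `(X, Y)` is a cotorsion pair: `X = ⊥Y` and `Y = X⊥`. -/
structure IsCotorsionPair (X Y : ObjectProperty A) : Prop where
  left_eq : X = leftPerp Y
  right_eq : Y = rightPerp X

/-- `(X, Z, Y)` is a cotorsion triple: `(X, Z)` and `(Z, Y)` are cotorsion pairs. -/
structure IsCotorsionTriple (X Z Y : ObjectProperty A) : Prop where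
  left_pair : IsCotorsionPair X Z
  right_pair : IsCotorsionPair Z Y

/-- `(X, Z, Y)` is a complete cotorsion triple: both cotorsion pairs are complete. -/
structure IsCompleteCotorsionTriple (X Z Y : ObjectProperty A) : Prop
    extends IsCotorsionTriple X Z Y where
  left_complete : IsCompletePair X Z
  right_complete : IsCompletePair Z Y

/-- `(X, Z, Y)` is a complete and hereditary cotorsion triple: in addition both cotorsion pairs are
hereditary, i.e. their left-hand classes `X` and `Z` are resolving. -/
structure IsCompleteHereditaryCotorsionTriple (X Z Y : ObjectProperty A) : Prop
    extends IsCompleteCotorsionTriple X Z Y where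
  left_hereditary : IsResolving X
  right_hereditary : IsResolving Z

/-- For a complete cotorsion triple `(X, Z, Y)`, every object has an `X`-resolution. -/
theorem IsCompleteCotorsionTriple.exists_isResolution {X Z Y : ObjectProperty A}
    (h : IsCompleteCotorsionTriple X Z Y) (M : A) :
    ∃ R : AugmentedComplex M, R.IsResolution X := by
  refine CotorsionTriple.exists_isResolution X (fun M => ?_) M
  obtain ⟨Z₀, X₀, f, g, w, hS, hX, hZ⟩ := h.left_complete.exists_left M
  refine ⟨X₀, g, hX, fun W hW a => ?_⟩
  rw [h.left_pair.left_eq] at hW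
  have := hW Z₀ hZ
  obtain ⟨b, hb⟩ := Abelian.Ext.covariant_sequence_exact₃ W hS (Abelian.Ext.mk₀ a)
    (zero_add 1) (Subsingleton.elim _ _)
  obtain ⟨b, rfl⟩ := (Abelian.Ext.mk₀_bijective _ _).2 b
  refine ⟨b, (Abelian.Ext.mk₀_bijective _ _).1 ?_⟩
  simpa using hb

/-- A chosen `X`-resolution of `M`. -/
noncomputable def IsCompleteCotorsionTriple.resolution {X Z Y : ObjectProperty A}
    (h : IsCompleteCotorsionTriple X Z Y) (M : A) : AugmentedComplex M :=
  (h.exists_isResolution M).choose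

/-- The relative extension group `Ext_{XY}^i(M, N) = H^i Hom(X•, N)`, computed from an
`X`-resolution `X• → M`. -/
noncomputable def IsCompleteCotorsionTriple.relExt {X Z Y : ObjectProperty A}
    (h : IsCompleteCotorsionTriple X Z Y) (M N : A) (i : ℕ) : AddCommGrpCat.{v} :=
  ((h.resolution M).homComplex N).homology i

/-- The `C`-projective dimension of `M`: the smallest `n : ℕ` such that `Ext^{n+i}(M, N) = 0` for
all `N` in `C` and all `i ≥ 1`, and `⊤` if there is no such `n`. -/
noncomputable def projDim (C : ObjectProperty A) (M : A) : ℕ∞ :=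
  sInf {m : ℕ∞ | ∃ n : ℕ, m = n ∧
    ∀ N, C N → ∀ i : ℕ, 1 ≤ i → Subsingleton (Abelian.Ext.{v} M N (n + i))}

end Triples

end CotorsionTriple

/-! An exact complex with terms in `X` is cut into short exact sequences `0 → Kₙ₊₁ → Cₙ → Kₙ → 0`.
As `X` is resolving, all positive `Ext` from `X` to `Z` vanish, so dimension shifting turns
`Ext¹(Kₙ, N) = 0` into `Ext^{n+1}(M, N) = 0` for `N` in `Z`. Since `X = ⊥Z`, membership of `Kₙ` in
`X` depends on `M` alone (`IsExact.ker_mem_iff`). This settles 2, 4, 5 and 6, because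
`X`-resolutions are exact: `X` contains the projectives.

For 3 (`IsResolution.ker_mem_iff_isZero_homology`), if `Kₙ` is in `X` then the sequences split from
index `n` on, and `Hom(-, N)` stays exact there. Conversely, vanishing for the single object `N =
Kₙ₊₁` in degree `n + 1` already splits the `n`-th sequence, so `Kₙ` is a summand of `Cₙ`. -/

namespace CotorsionTriple

section Classes

variable {A : Type u} [Category.{v} A] [Abelian A]

/-! ### Kernels and short exact sequences of an augmented complex -/

namespace AugmentedComplex

variable {M : A} (R : AugmentedComplex M)

/-- The inclusion `Kₙ₊₁ → Cₙ`. -/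
noncomputable def kerι : ∀ n : ℕ, R.ker (n + 1) ⟶ R.complex.X n
  | 0 => kernel.ι R.π
  | n + 1 => kernel.ι (R.complex.d (n + 1) n)

/-- The corestriction `Cₙ → Kₙ` of the differential. -/
noncomputable def toKer : ∀ n : ℕ, R.complex.X n ⟶ R.ker n
  | 0 => R.π
  | 1 => kernel.lift R.π (R.complex.d 1 0) R.d_comp_π
  | n + 2 => kernel.lift (R.complex.d (n + 1) n) (R.complex.d (n + 2) (n + 1)) (by simp)

instance mono_kerι (n : ℕ) : Mono (R.kerι n) := by
  cases n with
  | zero => exact inferInstanceAs (Mono (kernel.ι R.π))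
  | succ n => exact inferInstanceAs (Mono (kernel.ι (R.complex.d (n + 1) n)))

theorem toKer_kerι (n : ℕ) : R.toKer (n + 1) ≫ R.kerι n = R.complex.d (n + 1) n := by
  cases n
  · exact kernel.lift_ι _ _ _
  · exact kernel.lift_ι _ _ _

theorem kerι_toKer (n : ℕ) : R.kerι n ≫ R.toKer n = 0 := by
  cases n with
  | zero => exact kernel.condition _
  | succ n =>
    rw [← cancel_mono (R.kerι n), Category.assoc, toKer_kerι, zero_comp]
    exact kernel.condition _

/-- The short complex `0 → Kₙ₊₁ → Cₙ → Kₙ → 0`. -/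
noncomputable def kerSequence (n : ℕ) : ShortComplex A :=
  ShortComplex.mk (R.kerι n) (R.toKer n) (R.kerι_toKer n)

theorem exists_lift_kerι {n : ℕ} {W : A} (a : W ⟶ R.complex.X n) (ha : a ≫ R.toKer n = 0) :
    ∃ b : W ⟶ R.ker (n + 1), b ≫ R.kerι n = a := by
  cases n with
  | zero => exact ⟨kernel.lift _ a ha, kernel.lift_ι _ _ _⟩
  | succ n =>
    have ha' : a ≫ R.complex.d (n + 1) n = 0 := by
      rw [← toKer_kerι, reassoc_of% ha, zero_comp]
    exact ⟨kernel.lift _ a ha', kernel.lift_ι _ _ _⟩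

variable {R}

theorem IsExact.epi_toKer (h : R.IsExact) (n : ℕ) : Epi (R.toKer n) := by
  obtain _ | _ | n := n
  · exact h.epi
  · exact (ShortComplex.exact_iff_epi_kernel_lift _).1 h.exact_zero
  · have := h.exact_succ n
    rw [HomologicalComplex.exactAt_iff' _ (n + 2) (n + 1) n (by simp) (by simp)] at this
    exact (ShortComplex.exact_iff_epi_kernel_lift _).1 this

theorem IsExact.kerSequence_shortExact (h : R.IsExact) (n : ℕ) : (R.kerSequence n).ShortExact :=
  ShortComplex.ShortExact.mk'
    ((ShortComplex.exact_iff_exact_up_to_refinements _).2 fun W a ha => by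
      obtain ⟨b, hb⟩ := R.exists_lift_kerι a ha
      exact ⟨W, 𝟙 W, inferInstance, b, by rw [Category.id_comp]; exact hb.symm⟩)
    (R.mono_kerι n) (h.epi_toKer n)

/-- A map into `Kₙ₊₁` becomes a cycle in `Hom(W, Cₙ)`, hence a boundary; cancelling the mono `Kₙ₊₁ →
Cₙ` gives the lift. -/
theorem IsHomExact.surjective_toKer {W : A} (h : R.IsHomExact W) (n : ℕ) :
    Function.Surjective (fun f : W ⟶ R.complex.X n => f ≫ R.toKer n) := by
  cases n with
  | zero => exact h.surjective
  | succ n =>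
    intro a
    have ha : (a ≫ R.kerι n) ≫ R.toKer n = 0 := by
      rw [Category.assoc, kerι_toKer, comp_zero]
    have : ∃ b, b ≫ R.complex.d (n + 1) n = a ≫ R.kerι n := by
      cases n with
      | zero => exact (h.exact_zero _).1 ha
      | succ n =>
        refine (h.exact_succ n _).1 ?_
        change (a ≫ R.kerι (n + 1)) ≫ R.complex.d (n + 1) n = 0
        rw [← toKer_kerι, ← Category.assoc, ha, zero_comp]
    obtain ⟨b, hb⟩ := this
    refine ⟨b, ?_⟩
    dsimp only
    rw [← cancel_mono (R.kerι n), Category.assoc, toKer_kerι, hb]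

/-- A complex that is exact after applying `Hom(P, -)` for all projective objects `P` is exact. -/
theorem isExact_of_projective [EnoughProjectives A]
    (h : ∀ P : A, Projective P → R.IsHomExact P) : R.IsExact where
  -- Lifts are needed only after an epimorphism onto `W`, and a projective cover term
  -- `Projective.over W` supplies one.
  epi := (epi_iff_surjective_up_to_refinements _).2 fun {W} a => by
    obtain ⟨b, hb⟩ := (h (Projective.over W) inferInstance).surjective (Projective.π W ≫ a)
    exact ⟨_, Projective.π W, inferInstance, b, hb.symm⟩
  exact_zero := (ShortComplex.exact_iff_exact_up_to_refinements _).2 fun W a ha => by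
    obtain ⟨b, hb⟩ := ((h (Projective.over W) inferInstance).exact_zero (Projective.π W ≫ a)).1
      (by dsimp at ha ⊢; rw [Category.assoc, ha, comp_zero])
    exact ⟨_, Projective.π W, inferInstance, b, hb.symm⟩
  exact_succ i := by
    rw [HomologicalComplex.exactAt_iff' _ (i + 2) (i + 1) i (by simp) (by simp)]
    refine (ShortComplex.exact_iff_exact_up_to_refinements _).2 fun W
      (a : W ⟶ R.complex.X (i + 1)) (ha : a ≫ R.complex.d (i + 1) i = 0) => ?_
    obtain ⟨b, hb⟩ := ((h (Projective.over W) inferInstance).exact_succ i (Projective.π W ≫ a)).1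
      (by dsimp only; rw [Category.assoc, ha, comp_zero])
    exact ⟨_, Projective.π W, inferInstance, b, hb.symm⟩

theorem IsResolution.isExact [EnoughProjectives A] {X : ObjectProperty A} (hX : IsResolving X)
    (h : R.IsResolution X) : R.IsExact :=
  isExact_of_projective fun P hP => h.homExact P (hX.of_projective P hP)

/-- Once a kernel `Kₙ` of an `X`-resolution lies in `X`, so do all later ones. -/
theorem IsResolution.ker_add_mem [EnoughProjectives A] {X : ObjectProperty A} (hX : IsResolving X)
    (h : R.IsResolution X) {n : ℕ} (hn : X (R.ker n)) (i : ℕ) : X (R.ker (n + i)) := by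
  induction i with
  | zero => exact hn
  | succ i ih =>
    exact (hX.iff_of_shortExact _ ((h.isExact hX).kerSequence_shortExact (n + i)) ih).1 (h.mem _)

variable (R)

theorem isZero_homology_homComplex_succ_iff (N : A) (m : ℕ) :
    IsZero ((R.homComplex N).homology (m + 1)) ↔
      ∀ f : R.complex.X (m + 1) ⟶ N, R.complex.d (m + 2) (m + 1) ≫ f = 0 →
        ∃ g : R.complex.X m ⟶ N, R.complex.d (m + 1) m ≫ g = f := by
  rw [← HomologicalComplex.exactAt_iff_isZero_homology,
    HomologicalComplex.exactAt_iff' _ m (m + 1) (m + 2) (by simp) (by simp),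
    ShortComplex.ab_exact_iff]
  exact Iff.rfl

end AugmentedComplex

end Classes

/-! ### Dimension shifting and vanishing of extensions -/

section Triples

variable {A : Type u} [Category.{v} A] [Abelian A] [EnoughProjectives A]

/-- The identity of `Ext¹(K, N)` factors through `Ext¹(L, N) = 0`. -/
theorem leftPerp_of_retract {C : ObjectProperty A} {K L : A} (r : Retract K L)
    (hL : leftPerp C L) : leftPerp C K := fun N hN => by
  have := hL N hN
  refine subsingleton_of_forall_eq 0 fun x => ?_
  have hx : (Abelian.Ext.mk₀ r.r).comp x (zero_add 1) = 0 := Subsingleton.elim _ _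
  have := Abelian.Ext.mk₀_comp_mk₀_assoc r.i r.r x
  rw [hx] at this
  simpa using this.symm

/-- Dimension shifting along a short exact sequence `0 → S₁ → S₂ → S₃ → 0` whose middle term has
no higher extensions by `N`. -/
theorem subsingleton_ext_iff_of_shortExact {S : ShortComplex A} (hS : S.ShortExact) {N : A}
    (h₂ : ∀ i : ℕ, Subsingleton (Abelian.Ext.{v} S.X₂ N (i + 1))) (i : ℕ) :
    Subsingleton (Abelian.Ext.{v} S.X₁ N (i + 1)) ↔
      Subsingleton (Abelian.Ext.{v} S.X₃ N (i + 2)) := by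
  have := h₂ i
  have := h₂ (i + 1)
  refine ⟨fun h => subsingleton_of_forall_eq 0 fun x => ?_,
    fun h => subsingleton_of_forall_eq 0 fun x => ?_⟩
  · obtain ⟨y, rfl⟩ := Abelian.Ext.contravariant_sequence_exact₃ hS N x (Subsingleton.elim _ _)
      (n₀ := i + 1) (by omega)
    rw [Subsingleton.elim y 0, Abelian.Ext.comp_zero]
  · obtain ⟨y, rfl⟩ := Abelian.Ext.contravariant_sequence_exact₁ hS N x
      (n₁ := i + 2) (by omega) (Subsingleton.elim _ _)
    rw [Subsingleton.elim y 0, Abelian.Ext.comp_zero]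

/-- For a hereditary cotorsion pair all higher extensions between its two classes vanish. -/
theorem IsCotorsionPair.subsingleton_ext {X Z : ObjectProperty A} (h : IsCotorsionPair X Z)
    (hX : IsResolving X) {N : A} (hN : Z N) (i : ℕ) {L : A} (hL : X L) :
    Subsingleton (Abelian.Ext.{v} L N (i + 1)) := by
  induction i generalizing L with
  | zero =>
    rw [h.left_eq] at hL
    exact hL N hN
  | succ i ih =>
    -- The syzygy of `L` is again in `X`, so the induction hypothesis applies to it one degree
    -- lower.
    have hS : (ShortComplex.mk (kernel.ι (Projective.π L)) (Projective.π L)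
        (kernel.condition _)).ShortExact :=
      ShortComplex.ShortExact.mk' (ShortComplex.exact_of_f_is_kernel _ (kernelIsKernel _))
        inferInstance inferInstance
    refine (subsingleton_ext_iff_of_shortExact hS (N := N)
      (fun j => Abelian.Ext.subsingleton_of_projective _ _ j) i).1 (ih ?_)
    exact (hX.iff_of_shortExact _ hS hL).1 (hX.of_projective _ inferInstance)

namespace AugmentedComplex

variable {M : A} {R : AugmentedComplex M} {X Z : ObjectProperty A}

theorem IsExact.subsingleton_ext_ker_iff (hR : R.IsExact) (hmem : ∀ i, X (R.complex.X i))
    (h : IsCotorsionPair X Z) (hX : IsResolving X) {N : A} (hN : Z N) (n i : ℕ) :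
    Subsingleton (Abelian.Ext.{v} (R.ker n) N (i + 1)) ↔
      Subsingleton (Abelian.Ext.{v} M N (n + i + 1)) := by
  induction n generalizing i with
  | zero => rw [zero_add]; exact Iff.rfl
  | succ n ih =>
    have := subsingleton_ext_iff_of_shortExact (hR.kerSequence_shortExact n) (N := N)
      (fun j => h.subsingleton_ext hX hN j (hmem n)) i
    refine this.trans ((ih (i + 1)).trans ?_)
    rw [show n + (i + 1) + 1 = n + 1 + i + 1 by omega]

/-- For an exact complex with terms in the left-hand class `X` of a hereditary cotorsion pair
`(X, Z)`, the `n`-th kernel lies in `X` if and only if the extensions of `M` by objects of `Z`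
vanish above degree `n`. -/
theorem IsExact.ker_mem_iff (hR : R.IsExact) (hmem : ∀ i, X (R.complex.X i))
    (h : IsCotorsionPair X Z) (hX : IsResolving X) (n : ℕ) :
    X (R.ker n) ↔
      ∀ N : A, Z N → ∀ i : ℕ, 1 ≤ i → Subsingleton (Abelian.Ext.{v} M N (n + i)) := by
  constructor
  · intro hn N hN i hi
    obtain ⟨i, rfl⟩ := Nat.exists_eq_add_of_le' hi
    exact (hR.subsingleton_ext_ker_iff hmem h hX hN n i).1 (h.subsingleton_ext hX hN i hn)
  · intro H
    rw [h.left_eq]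
    exact fun N hN => (hR.subsingleton_ext_ker_iff hmem h hX hN n 0).2 (H N hN 1 le_rfl)

/-- For an `X`-resolution, the `n`-th kernel lies in `X` if and only if all relative extension
groups computed from it vanish above degree `n`. -/
theorem IsResolution.ker_mem_iff_isZero_homology (hR : R.IsResolution X)
    (h : IsCotorsionPair X Z) (hX : IsResolving X) (n : ℕ) :
    X (R.ker n) ↔
      ∀ (N : A) (i : ℕ), 1 ≤ i → IsZero ((R.homComplex N).homology (n + i)) := by
  have hE := hR.isExact hX
  constructor
  · intro hn N i hi
    obtain ⟨i, rfl⟩ := Nat.exists_eq_add_of_le' hi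
    rw [← add_assoc, isZero_homology_homComplex_succ_iff]
    generalize hm : n + i = m
    have hK : X (R.ker m) := hm ▸ hR.ker_add_mem hX hn i
    intro f hf
    have hS := hE.kerSequence_shortExact m
    have hS' := hE.kerSequence_shortExact (m + 1)
    have := hS'.epi_g
    -- As `Kₘ` is in `X`, its identity lifts to `Cₘ`. The resulting retraction `Cₘ → Kₘ₊₁` extends
    -- the map on `Kₘ₊₁` induced by the cocycle `f`.
    obtain ⟨s, hs⟩ := (hR.homExact _ hK).surjective_toKer m (𝟙 _)
    let σ := ShortComplex.Splitting.ofExactOfSection _ hS.exact s hs hS.mono_f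
    have hf' : R.kerι (m + 1) ≫ f = 0 := by
      have := hE.epi_toKer (m + 2)
      rw [← cancel_epi (R.toKer (m + 2)), ← Category.assoc, toKer_kerι, hf, comp_zero]
    obtain ⟨g, hg⟩ : ∃ g : R.ker (m + 1) ⟶ N, R.toKer (m + 1) ≫ g = f :=
      hS'.exact.desc' f hf'
    obtain ⟨r, hr⟩ : ∃ r : R.complex.X m ⟶ R.ker (m + 1), R.kerι m ≫ r = 𝟙 _ := ⟨σ.r, σ.f_r⟩
    exact ⟨r ≫ g, by rw [← toKer_kerι, Category.assoc, reassoc_of% hr, hg]⟩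
  · intro H
    have hS := hE.kerSequence_shortExact n
    have hd : R.complex.d (n + 2) (n + 1) ≫ R.toKer (n + 1) = 0 := by
      rw [← cancel_mono (R.kerι n), Category.assoc, toKer_kerι, zero_comp,
        HomologicalComplex.d_comp_d]
    -- The map `Cₙ₊₁ → Kₙ₊₁` is the universal cocycle; writing it as a coboundary yields a
    -- retraction of `Kₙ₊₁ → Cₙ`.
    obtain ⟨r, hr⟩ := (R.isZero_homology_homComplex_succ_iff _ n).1 (H (R.ker (n + 1)) 1 le_rfl)
      (R.toKer (n + 1)) hd
    have := hE.epi_toKer (n + 1)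
    have hr' : R.kerι n ≫ r = 𝟙 _ := by
      rw [← cancel_epi (R.toKer (n + 1)), ← Category.assoc, toKer_kerι, hr, Category.comp_id]
    let σ := ShortComplex.Splitting.ofExactOfRetraction _ hS.exact r hr' hS.epi_g
    have hmem := hR.mem n
    rw [h.left_eq] at hmem ⊢
    exact leftPerp_of_retract ⟨σ.s, R.toKer n, σ.s_g⟩ hmem

end AugmentedComplex

theorem projDim_le_iff (C : ObjectProperty A) (M : A) (n : ℕ) :
    projDim C M ≤ n ↔
      ∀ N : A, C N → ∀ i : ℕ, 1 ≤ i → Subsingleton (Abelian.Ext.{v} M N (n + i)) := by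
  refine ⟨fun h N hN i hi => ?_, fun h => sInf_le ⟨n, rfl, h⟩⟩
  -- A strict bound on the infimum produces an actual index `m ≤ n` in the set.
  have hlt : projDim C M < (n + 1 : ℕ) := lt_of_le_of_lt h (by exact_mod_cast n.lt_succ_self)
  obtain ⟨_, ⟨m, rfl, hm⟩, hmn⟩ := sInf_lt_iff.1 hlt
  have hmn : m < n + 1 := by exact_mod_cast hmn
  rw [show n + i = m + (n - m + i) by omega]
  exact hm N hN _ (by omega)

end Triples

end CotorsionTriple

theorem theorem4p6 {A : Type u} [Category.{v} A] [Abelian A] [EnoughProjectives A]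
    [EnoughInjectives A] (X Z Y : ObjectProperty A)
    (h : CotorsionTriple.IsCompleteHereditaryCotorsionTriple X Z Y) (M : A) (n : ℕ) :
    List.TFAE [
      CotorsionTriple.projDim Z M ≤ n,
      ∀ N : A, Z N → ∀ i : ℕ, 1 ≤ i → Subsingleton (Abelian.Ext.{v} M N (n + i)),
      ∀ (N : A) (i : ℕ), 1 ≤ i →
        IsZero (h.toIsCompleteCotorsionTriple.relExt M N (n + i)),
      ∀ R : CotorsionTriple.AugmentedComplex M, R.IsResolution X → X (R.ker n),
      ∃ R : CotorsionTriple.AugmentedComplex M, R.IsResolution X ∧ X (R.ker n),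
      ∀ R : CotorsionTriple.AugmentedComplex M, R.IsExact → (∀ i, X (R.complex.X i)) →
        X (R.ker n)] := by
  have hP := h.left_pair
  have hX := h.left_hereditary
  obtain ⟨R₀, hR₀⟩ := h.toIsCompleteCotorsionTriple.exists_isResolution M
  tfae_have 1 ↔ 2 := CotorsionTriple.projDim_le_iff Z M n
  tfae_have 2 → 6 := fun H R hR hmem => (hR.ker_mem_iff hmem hP hX n).2 H
  tfae_have 6 → 4 := fun H R hR => H R (hR.isExact hX) hR.mem
  tfae_have 4 → 5 := fun H => ⟨R₀, hR₀, H R₀ hR₀⟩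
  tfae_have 5 → 2 := fun ⟨_, hR, hn⟩ => ((hR.isExact hX).ker_mem_iff hR.mem hP hX n).1 hn
  -- `relExt` is computed from this chosen resolution, so 3 is compared with 4 and 5 through it and
  -- no independence of the choice is needed.
  have hres := (h.toIsCompleteCotorsionTriple.exists_isResolution M).choose_spec
  tfae_have 4 → 3 := fun H => (hres.ker_mem_iff_isZero_homology hP hX n).1 (H _ hres)
  tfae_have 3 → 5 := fun H => ⟨_, hres, (hres.ker_mem_iff_isZero_homology hP hX n).2 H⟩
  tfae_finish
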